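/- \textbf{Setting.} A \emph{cell complex} $K$ in $\mathbb{R}^d$ is a collection of subsets (cells), each homeomorphic to a closed unit ball of some dimension $\le d$, such that the boundary of each cell is a union of lower-dimensional cells (its \emph{faces}) and two different cells meet in a (possibly empty) union of common faces, where a cell counts as a face of itself for this purpose; $K$ is assumed to be locally finite in $\mathbb{R}^d$. A \emph{filter} is a function $f\colon K\to\mathbb{R}$ with $f(\sigma)\le f(\tau)$ whenever $\sigma$ is a face of $\tau$. For a $d$-dimensional lattice $\Lambda\subseteq\mathbb{R}^d$, $K$ is \emph{$\Lambda$-periodic} if $\sigma+u\in K$ for all $\sigma\in K$, $u\in\Lambda$, and $f$ is $\Lambda$-periodic if moreover $f(\sigma+u)=f(\sigma)$. Identifying cells that are translates by vectors of $\Lambda$ gives the quotient complex $K/\Lambda$ on the torus $\mathbb{R}^d/\Lambda$ and the quotient filter $f/\Lambda$; write $(K/\Lambda)_t$ for the union of the cells of $K/\Lambda$ with value at most $t$. \textbf{Periodic merge tree.} Let $\mathcal{S}=\{(x,s)\in (\mathbb{R}^d/\Lambda)\times\mathbb{R} : x\in (K/\Lambda)_s\}$, and let $(x,s)\sim(y,t)$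 if $s=t$ and $x,y$ lie in the same connected component of $(K/\Lambda)_s$. The periodic merge tree $M(f,\Lambda)$ is $\mathcal{S}/{\sim}$ with the quotient topology; its points are the connected components $C$ of the sublevel sets. It carries the height function $h$ induced by $(x,s)\mapsto s$, and the frequency function $F$ that maps $C$ to its \emph{shadow monomial} $$F(C)=\frac{\mathrm{vol}_p(\Lambda_C)}{\mathrm{vol}_d(\Lambda)}\,\nu_{d-p}\,R^{d-p},$$ where $\Lambda_C$ is the lattice of all $u\in\Lambda$ with $c+u=c$ for every connected component $c$ of the preimage of $C$ in $\mathbb{R}^d$, $p=\dim\Lambda_C$, $\mathrm{vol}$ is the volume of a unit cell (in the span of the lattice), and $\nu_q$ is the volume of the unit ball in $\mathbb{R}^q$. A point $B$ \emph{covers} $A$ if $h(A)\le h(B)$ and $A\subseteq B$ as sets; $M_C$ is the subtree of all points covered by $C$, with the inherited data. Monomials are ordered first by exponent, then by coefficient. \textbf{Interleaving distance.} For such trees (or subtrees) $M,N$ with height functions $h_M,h_N$ and frequency functions $F_M,F_N$, and for $\varepsilon\ge 0$, continuous maps $\varphi\colon M\to N$ and $\psi\colon N\to M$ are $\varepsilon$-compatible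 if $h_N\circ\varphi=h_M+\varepsilon$, $h_M\circ\psi=h_N+\varepsilon$, $\psi\varphi(C)$ covers $C$ and $\varphi\psi(C')$ covers $C'$, $F_N(\varphi(C))\le F_M(C)$ and $F_M(\psi(C'))\le F_N(C')$, for all $C\in M$ and $C'\in N$. The distance $I(M,N)$ is the infimum of the $\varepsilon\geq 0$ that admit $\varepsilon$-compatible maps ($\infty$ if there are none). \textbf{Lemma (Splintering from Sublattice).} Let $\Lambda\subseteq\mathbb{R}^d$ be a $d$-dimensional lattice, $f\colon K\to\mathbb{R}$ a $\Lambda$-periodic filter on a $\Lambda$-periodic locally finite cell complex $K$ in $\mathbb{R}^d$, and $\Lambda'\subseteq\Lambda$ a $d$-dimensional sublattice. Then $M'=M(f,\Lambda')$ \emph{splinters} $M=M(f,\Lambda)$; that is, there is a continuous surjection $\omega\colon M'\to M$ such that (i) $\omega$ preserves height: $h(\omega(A))=h'(A)$ for all $A\in M'$; (ii) $\omega$ splits subtrees evenly: for every $C\in M$ the preimage $\omega^{-1}(C)$ is finite, and for all $A,B\in\omega^{-1}(C)$ we have $I(M'_A,M'_B)=0$, $\omega$ maps $M'_A$ (and likewise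 $M'_B$) onto $M_C$, and $F'(A)=F'(B)=F(C)/\#\omega^{-1}(C)$. -/

import Mathlib

open scoped NNReal ENNReal

noncomputable section

namespace PeriodicMerge

/-- Euclidean space of dimension `d`. -/
abbrev E (d : ℕ) : Type := EuclideanSpace ℝ (Fin d)

/-- The closed unit ball of dimension `n`. -/
abbrev UnitBall (n : ℕ) : Type := Metric.closedBall (0 : E n) 1

/-- The translate `A + u`. -/
def translate {d : ℕ} (u : E d) (A : Set (E d)) : Set (E d) := (fun x => x + u) '' A

theorem translate_zero {d : ℕ} (A : Set (E d)) : translate 0 A = A := by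
  simp [translate]

theorem translate_translate {d : ℕ} (u v : E d) (A : Set (E d)) :
    translate v (translate u A) = translate (u + v) A := by
  unfold translate
  rw [Set.image_image]
  simp only [add_assoc]

/-! ### Cell complexes and filters -/

/-- The boundary of a cell: the image of the unit sphere under a homeomorphism from the ball. -/
def cellBoundary {d n : ℕ} {σ : Set (E d)} (h : UnitBall n ≃ₜ σ) : Set (E d) :=
  (fun y : UnitBall n => (h y : E d)) '' {y | ‖(y : E n)‖ = 1}

/-- A locally finite cell complex in `ℝ^d`. Its cells are closed topological balls, the boundary
of a cell is a union of lower-dimensional cells, and two different cells meet in a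
(possibly empty) union of common faces, where a cell is an (improper) face of itself. -/
structure CellComplex (d : ℕ) where
  /-- The cells, as closed subsets of `ℝ^d`. -/
  cells : Set (Set (E d))
  /-- The dimension of a cell. -/
  dim : cells → ℕ
  dim_le : ∀ σ, dim σ ≤ d
  /-- Each cell is homeomorphic to a closed ball. -/
  chart : ∀ σ : cells, UnitBall (dim σ) ≃ₜ (σ : Set (E d))
  boundary_eq : ∀ τ : cells, cellBoundary (chart τ) =
    ⋃ σ ∈ {σ : cells | dim σ < dim τ ∧ (σ : Set (E d)) ⊆ cellBoundary (chart τ)}, (σ : Set (E d))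
  inter_eq : ∀ σ τ : cells, σ ≠ τ → (σ : Set (E d)) ∩ (τ : Set (E d)) =
    ⋃ ρ ∈ {ρ : cells | (ρ = σ ∨ (ρ : Set (E d)) ⊆ cellBoundary (chart σ)) ∧
      (ρ = τ ∨ (ρ : Set (E d)) ⊆ cellBoundary (chart τ))}, (ρ : Set (E d))
  locallyFinite : LocallyFinite fun σ : cells => (σ : Set (E d))

/-- `σ` is a (proper) face of `τ`. -/
def CellComplex.IsFace {d : ℕ} (K : CellComplex d) (σ τ : K.cells) : Prop :=
  K.dim σ < K.dim τ ∧ (σ : Set (E d)) ⊆ cellBoundary (K.chart τ)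

/-- A filter of `K`: a real function on the cells that is monotone along the face relation. -/
structure CellFilter {d : ℕ} (K : CellComplex d) where
  /-- The value of a cell. -/
  val : K.cells → ℝ
  mono : ∀ σ τ, K.IsFace σ τ → val σ ≤ val τ

/-- `K` is `Λ`-periodic. -/
def CellComplex.IsPeriodic {d : ℕ} (K : CellComplex d) (Λ : Submodule ℤ (E d)) : Prop :=
  ∀ σ ∈ K.cells, ∀ u ∈ Λ, translate u σ ∈ K.cells

/-- `f` is `Λ`-periodic. -/
def CellFilter.IsPeriodic {d : ℕ} {K : CellComplex d} (f : CellFilter K)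
    (Λ : Submodule ℤ (E d)) : Prop :=
  ∀ σ τ : K.cells, ∀ u ∈ Λ, (τ : Set (E d)) = translate u σ → f.val σ = f.val τ

theorem CellComplex.IsPeriodic.mono {d : ℕ} {K : CellComplex d} {Λ Λ' : Submodule ℤ (E d)}
    (hK : K.IsPeriodic Λ) (h : Λ' ≤ Λ) : K.IsPeriodic Λ' :=
  fun σ hσ u hu => hK σ hσ u (h hu)

theorem CellFilter.IsPeriodic.mono {d : ℕ} {K : CellComplex d} {f : CellFilter K}
    {Λ Λ' : Submodule ℤ (E d)} (hf : f.IsPeriodic Λ) (h : Λ' ≤ Λ) : f.IsPeriodic Λ' :=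
  fun σ τ u hu => hf σ τ u (h hu)

/-! ### The quotient complex on the torus -/

/-- The torus `ℝ^d / Λ` (with the quotient topology). -/
abbrev Torus {d : ℕ} (Λ : Submodule ℤ (E d)) : Type := E d ⧸ Λ

/-- Two cells are identified if they are translates by a vector of `Λ`. -/
def cellSetoid {d : ℕ} (K : CellComplex d) (Λ : Submodule ℤ (E d)) : Setoid K.cells where
  r σ τ := ∃ u ∈ Λ, (τ : Set (E d)) = translate u σ
  iseqv :=
    { refl := fun σ => ⟨0, Λ.zero_mem, (translate_zero _).symm⟩
      symm := by
        rintro σ τ ⟨u, hu, h⟩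
        exact ⟨-u, Λ.neg_mem hu, by rw [h, translate_translate, add_neg_cancel, translate_zero]⟩
      trans := by
        rintro σ τ ρ ⟨u, hu, h⟩ ⟨v, hv, h'⟩
        exact ⟨u + v, Λ.add_mem hu hv, by rw [h', h, translate_translate]⟩ }

/-- The cells of the quotient complex `K/Λ`. -/
def QuotientCell {d : ℕ} (K : CellComplex d) (Λ : Submodule ℤ (E d)) : Type :=
  Quotient (cellSetoid K Λ)

/-- The subset of the torus covered by a cell of `K/Λ`. -/
def QuotientCell.carrier {d : ℕ} {K : CellComplex d} {Λ : Submodule ℤ (E d)}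
    (c : QuotientCell K Λ) : Set (Torus Λ) :=
  Quotient.lift (s := cellSetoid K Λ)
    (fun σ : K.cells => (fun x : E d => (Submodule.Quotient.mk x : Torus Λ)) '' (σ : Set (E d)))
    (by
      rintro σ τ ⟨u, hu, h⟩
      simp only [h, translate, Set.image_image]
      refine Set.image_congr fun x _ => ?_
      rw [Submodule.Quotient.mk_add, (Submodule.Quotient.mk_eq_zero Λ).2 hu, add_zero]) c

/-- The quotient filter `f/Λ : K/Λ → ℝ`. -/
def CellFilter.quotient {d : ℕ} {K : CellComplex d} (f : CellFilter K) {Λ : Submodule ℤ (E d)}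
    (hf : f.IsPeriodic Λ) : QuotientCell K Λ → ℝ :=
  Quotient.lift (s := cellSetoid K Λ) f.val (by
    rintro σ τ ⟨u, hu, h⟩
    exact hf σ τ u hu h)

/-- The underlying space of the sublevel set `(K/Λ)_t` of the quotient filter. -/
def CellFilter.quotientSublevel {d : ℕ} {K : CellComplex d} (f : CellFilter K)
    {Λ : Submodule ℤ (E d)} (hf : f.IsPeriodic Λ) (t : ℝ) : Set (Torus Λ) :=
  ⋃ c ∈ {c : QuotientCell K Λ | f.quotient hf c ≤ t}, c.carrier

/-! ### Merge trees -/

/-- The sublevel space `{(x, s) | x ∈ S s}`, with the topology inherited from `X × ℝ`. -/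
abbrev SublevelSpace {X : Type} (S : ℝ → Set X) : Type := {p : X × ℝ // p.1 ∈ S p.2}

/-- `(x, s) ∼ (y, t)` if `s = t` and `x`, `y` lie in the same connected component of `S s`. -/
def mergeSetoid {X : Type} [TopologicalSpace X] (S : ℝ → Set X) : Setoid (SublevelSpace S) where
  r p q := p.1.2 = q.1.2 ∧
    connectedComponentIn (S p.1.2) p.1.1 = connectedComponentIn (S q.1.2) q.1.1
  iseqv :=
    { refl := fun _ => ⟨rfl, rfl⟩
      symm := fun h => ⟨h.1.symm, h.2.symm⟩
      trans := fun h h' => ⟨h.1.trans h'.1, h.2.trans h'.2⟩ }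

/-- The merge tree of a family of sublevel sets. -/
def MergeTree {X : Type} [TopologicalSpace X] (S : ℝ → Set X) : Type := Quotient (mergeSetoid S)

instance {X : Type} [TopologicalSpace X] (S : ℝ → Set X) : TopologicalSpace (MergeTree S) :=
  inferInstanceAs (TopologicalSpace (Quotient (mergeSetoid S)))

/-- The height function of a merge tree. -/
def MergeTree.height {X : Type} [TopologicalSpace X] {S : ℝ → Set X} : MergeTree S → ℝ :=
  Quotient.lift (s := mergeSetoid S) (fun p => p.1.2) (fun _ _ h => h.1)

/-- The connected component that a point of a merge tree represents. -/
def MergeTree.component {X : Type} [TopologicalSpace X] {S : ℝ → Set X} : MergeTree S → Set X :=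
  Quotient.lift (s := mergeSetoid S) (fun p => connectedComponentIn (S p.1.2) p.1.1)
    (fun _ _ h => h.2)

/-! ### Shadow monomials -/

/-- A monomial `coeff * R ^ exponent` in the variable `R`. -/
@[ext]
structure RMonomial where
  /-- The coefficient. -/
  coeff : ℝ
  /-- The exponent. -/
  exponent : ℕ

/-- Monomials are compared by exponent, and by coefficient if the exponents agree. -/
instance : LE RMonomial where
  le m n := m.exponent < n.exponent ∨ (m.exponent = n.exponent ∧ m.coeff ≤ n.coeff)

/-- Division of a monomial by a natural number. -/
def RMonomial.divNat (m : RMonomial) (k : ℕ) : RMonomial := ⟨m.coeff / k, m.exponent⟩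

/-- The volume of the unit ball in `ℝ^q`. -/
def unitBallVolume (q : ℕ) : ℝ := (MeasureTheory.volume (Metric.ball (0 : E q) 1)).toReal

/-- The volume of a unit cell of a lattice `L` of arbitrary dimension, measured by the
Lebesgue measure of the Euclidean space spanned by `L`. -/
def latticeVolume {d : ℕ} (L : Submodule ℤ (E d)) : ℝ :=
  ZLattice.covolume
    (ZLattice.comap ℝ L (Submodule.span ℝ (L : Set (E d))).subtype) MeasureTheory.volume

/-- The preimage of a subset of the torus in `ℝ^d`. -/
def lift {d : ℕ} {Λ : Submodule ℤ (E d)} (C : Set (Torus Λ)) : Set (E d) :=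
  (fun x : E d => (Submodule.Quotient.mk x : Torus Λ)) ⁻¹' C

/-- The shadows of `C`: the connected components of its preimage in `ℝ^d`. -/
def shadows {d : ℕ} {Λ : Submodule ℤ (E d)} (C : Set (Torus Λ)) : Set (Set (E d)) :=
  (fun x => connectedComponentIn (lift C) x) '' lift C

/-- The periodicity lattice of `C`: the vectors of `Λ` that keep every shadow invariant. -/
def periodicityLattice {d : ℕ} {Λ : Submodule ℤ (E d)} (C : Set (Torus Λ)) :
    Submodule ℤ (E d) :=
  AddSubgroup.toIntSubmodule
    { carrier := {u | u ∈ Λ ∧ ∀ c ∈ shadows C, translate u c = c}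
      zero_mem' := ⟨Λ.zero_mem, fun c _ => translate_zero c⟩
      add_mem' := by
        rintro u v ⟨hu, hu'⟩ ⟨hv, hv'⟩
        refine ⟨Λ.add_mem hu hv, fun c hc => ?_⟩
        rw [← translate_translate, hu' c hc, hv' c hc]
      neg_mem' := by
        rintro u ⟨hu, hu'⟩
        refine ⟨Λ.neg_mem hu, fun c hc => ?_⟩
        have h : translate (-u) (translate u c) = c := by
          rw [translate_translate, add_neg_cancel, translate_zero]
        rwa [hu' c hc] at h }

/-- The shadow monomial of `C`: with `p` the dimension of the periodicity lattice `Λ_C`, it is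
`vol_p(Λ_C) / vol_d(Λ) * ν_{d-p} * R^{d-p}`. -/
def shadowMonomial {d : ℕ} {Λ : Submodule ℤ (E d)} (C : Set (Torus Λ)) : RMonomial where
  coeff := latticeVolume (periodicityLattice C) / latticeVolume Λ *
    unitBallVolume (d - Module.finrank ℤ (periodicityLattice C))
  exponent := d - Module.finrank ℤ (periodicityLattice C)

/-! ### Periodic merge trees, interleaving distance, splintering -/

/-- A tree decorated with a height function and a frequency function, whose points represent
subsets (components) of a space `X`. -/
structure DecoratedTree (X : Type) where
  /-- The points of the tree. -/
  Point : Type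
  /-- The topology of the tree. -/
  top : TopologicalSpace Point
  /-- The component that a point represents. -/
  component : Point → Set X
  /-- The height function. -/
  height : Point → ℝ
  /-- The frequency function. -/
  frequency : Point → RMonomial

instance {X : Type} (M : DecoratedTree X) : TopologicalSpace M.Point := M.top

/-- `b` covers `a`. -/
def DecoratedTree.Covers {X : Type} (M : DecoratedTree X) (b a : M.Point) : Prop :=
  M.height a ≤ M.height b ∧ M.component a ⊆ M.component b

/-- The subtree with topmost point `c`: all points covered by `c`, with the inherited data. -/
def DecoratedTree.subtree {X : Type} (M : DecoratedTree X) (c : M.Point) : DecoratedTree X where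
  Point := {a : M.Point // M.Covers c a}
  top := inferInstance
  component a := M.component a
  height a := M.height a
  frequency a := M.frequency a

/-- The periodic merge tree of `f` with respect to `Λ`: the merge tree of the quotient filter
`f/Λ`, with its height function and the shadow monomials. -/
def periodicMergeTree {d : ℕ} {K : CellComplex d} (f : CellFilter K) (Λ : Submodule ℤ (E d))
    (hf : f.IsPeriodic Λ) : DecoratedTree (Torus Λ) where
  Point := MergeTree (f.quotientSublevel hf)
  top := inferInstance
  component := MergeTree.component
  height := MergeTree.height
  frequency C := shadowMonomial C.component

/-- `φ` and `ψ` are `ε`-compatible maps between the trees `M` and `N`. -/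
structure Compatible {X Y : Type} (M : DecoratedTree X) (N : DecoratedTree Y) (ε : ℝ≥0)
    (φ : M.Point → N.Point) (ψ : N.Point → M.Point) : Prop where
  continuous_left : Continuous φ
  continuous_right : Continuous ψ
  height_left : ∀ c, N.height (φ c) = M.height c + ε
  height_right : ∀ c, M.height (ψ c) = N.height c + ε
  covers_left : ∀ c, M.Covers (ψ (φ c)) c
  covers_right : ∀ c, N.Covers (φ (ψ c)) c
  frequency_left : ∀ c, N.frequency (φ c) ≤ M.frequency c
  frequency_right : ∀ c, M.frequency (ψ c) ≤ N.frequency c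

/-- The interleaving distance: the infimum of the `ε ≥ 0` that admit `ε`-compatible maps
(`∞` if there is no such `ε`). -/
def interleavingDist {X Y : Type} (M : DecoratedTree X) (N : DecoratedTree Y) : ℝ≥0∞ :=
  ⨅ (ε : ℝ≥0) (_ : ∃ φ ψ, Compatible M N ε φ ψ), (ε : ℝ≥0∞)

/-- The map `ω` is a splintering of the tree `M` by the tree `M'`. -/
structure IsSplintering {X X' : Type} (M' : DecoratedTree X') (M : DecoratedTree X)
    (ω : M'.Point → M.Point) : Prop where
  continuous : Continuous ω
  surjective : Function.Surjective ω
  height_eq : ∀ a, M.height (ω a) = M'.height a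
  finite_fiber : ∀ c, (ω ⁻¹' {c}).Finite
  subtree_eq : ∀ c, ∀ a ∈ ω ⁻¹' {c}, ∀ b ∈ ω ⁻¹' {c},
    interleavingDist (M'.subtree a) (M'.subtree b) = 0
  subtree_surj : ∀ c, ∀ a ∈ ω ⁻¹' {c}, ω '' {b | M'.Covers a b} = {b | M.Covers c b}
  frequency_eq : ∀ c, ∀ a ∈ ω ⁻¹' {c},
    M'.frequency a = (M.frequency c).divNat (ω ⁻¹' {c}).ncard

/-- `M'` splinters `M`. -/
def Splinters {X X' : Type} (M' : DecoratedTree X') (M : DecoratedTree X) : Prop :=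
  ∃ ω : M'.Point → M.Point, IsSplintering M' M ω

end PeriodicMerge

end

open PeriodicMerge

/-!
The cells form a locally finite family of closed connected sets, so the components of a sublevel
set are relatively open in it. As the projection to the torus is open and `Λ` acts transitively on
its fibers, a component on the torus is therefore the full image of each of its shadows, and the
fibers of the natural map `M(f, Λ') → M(f, Λ)` are orbits of `Λ`, which acts on `M(f, Λ')` by deck
transformations. These preserve height, covering and frequency, so they identify the subtrees below
the points of a fiber.

The points over `C` have stabilizer `Λ' + Λ_C`, so there are `[Λ : Λ' + Λ_C]` of them, and each has
periodicity lattice `Λ' ∩ Λ_C`, which has the dimension of `Λ_C`. Passing from `C` to such a point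
multiplies the coefficient of the shadow monomial by `[Λ_C : Λ' ∩ Λ_C] / [Λ : Λ']`, which is
`1 / [Λ : Λ' + Λ_C]` by the second isomorphism theorem.
-/

noncomputable section

namespace PeriodicMerge

open MeasureTheory Submodule

section LatticeVolume

theorem span_eq_span_of_relIndex_ne_zero {𝕜 V : Type*} [DivisionRing 𝕜] [CharZero 𝕜]
    [AddCommGroup V] [Module 𝕜 V] {A B : AddSubgroup V} (h : A ≤ B) (hindex : A.relIndex B ≠ 0) :
    span 𝕜 (A : Set V) = span 𝕜 (B : Set V) := by
  refine le_antisymm (span_mono h) (span_le.2 fun x hx => ?_)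
  obtain ⟨n, hn, -, hnx⟩ := AddSubgroup.exists_nsmul_mem_of_relIndex_ne_zero hindex hx
  have hspan : (n : 𝕜) • x ∈ span 𝕜 (A : Set V) := by
    rw [Nat.cast_smul_eq_nsmul]
    exact subset_span hnx.1
  exact (smul_mem_iff _ (Nat.cast_ne_zero.2 hn.ne')).1 hspan

theorem finrank_int_eq_finrank_span {V : Type*} [NormedAddCommGroup V] [NormedSpace ℝ V]
    [FiniteDimensional ℝ V] (L : Submodule ℤ V) [DiscreteTopology L] :
    Module.finrank ℤ L = Module.finrank ℝ (span ℝ (L : Set V)) := by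
  have hset := Real.finrank_eq_int_finrank_of_discrete (s := (L : Set V)) (by rwa [span_eq])
  rw [Set.finrank, Set.finrank, span_eq] at hset
  exact hset.symm

theorem relIndex_ne_zero_of_isZLattice {V : Type*} [NormedAddCommGroup V] [InnerProductSpace ℝ V]
    [FiniteDimensional ℝ V] {L' L : Submodule ℤ V} [DiscreteTopology L] [IsZLattice ℝ L]
    [DiscreteTopology L'] [IsZLattice ℝ L'] (h : L' ≤ L) :
    L'.toAddSubgroup.relIndex L.toAddSubgroup ≠ 0 := by
  borelize V
  have hindex := ZLattice.covolume_div_covolume_eq_relIndex' L' L h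
  exact Nat.cast_ne_zero.1 (hindex ▸
    div_pos (ZLattice.covolume_pos L' volume) (ZLattice.covolume_pos L volume)).ne'

theorem discreteTopology_comap_subtype {V : Type*} [NormedAddCommGroup V] [NormedSpace ℝ V]
    (L : Submodule ℤ V) [DiscreteTopology L] (W : Submodule ℝ V) :
    DiscreteTopology (ZLattice.comap ℝ L W.subtype) :=
  ZLattice.comap_discreteTopology ℝ L continuous_subtype_val W.injective_subtype

theorem span_comap_subtype {V : Type*} [NormedAddCommGroup V] [NormedSpace ℝ V]
    {L : Submodule ℤ V} {W : Submodule ℝ V} (hW : span ℝ (L : Set V) = W) :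
    span ℝ (ZLattice.comap ℝ L W.subtype : Set W) = ⊤ := by
  subst hW
  rw [ZLattice.coe_comap, span_preimage_eq ⟨0, L.zero_mem⟩, comap_subtype_self]
  rw [LinearMap.coe_range, coe_subtype, Subtype.range_coe]
  exact subset_span

theorem relIndex_comap_subtype {V : Type*} [NormedAddCommGroup V] [NormedSpace ℝ V]
    {L : Submodule ℤ V} {W : Submodule ℝ V} (hL : span ℝ (L : Set V) ≤ W) (L' : Submodule ℤ V) :
    (ZLattice.comap ℝ L' W.subtype).toAddSubgroup.relIndex
      (ZLattice.comap ℝ L W.subtype).toAddSubgroup =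
    L'.toAddSubgroup.relIndex L.toAddSubgroup := by
  have hrange : L.toAddSubgroup ≤ W.subtype.toAddMonoidHom.range :=
    fun x hx => ⟨⟨x, hL (subset_span hx)⟩, rfl⟩
  rw [ZLattice.comap_toAddSubgroup, ZLattice.comap_toAddSubgroup, AddSubgroup.relIndex_comap,
    AddSubgroup.map_comap_eq_self hrange]

theorem span_inf_eq_span {𝕜 V : Type*} [DivisionRing 𝕜] [CharZero 𝕜] [AddCommGroup V] [Module 𝕜 V]
    {Λ Λ' L : Submodule ℤ V} (hindex : Λ'.toAddSubgroup.relIndex Λ.toAddSubgroup ≠ 0)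
    (hL : L ≤ Λ) : span 𝕜 ((Λ' ⊓ L : Submodule ℤ V) : Set V) = span 𝕜 (L : Set V) := by
  refine span_eq_span_of_relIndex_ne_zero (A := Λ'.toAddSubgroup ⊓ L.toAddSubgroup)
    (B := L.toAddSubgroup) inf_le_right ?_
  rw [AddSubgroup.inf_relIndex_right]
  exact mt (AddSubgroup.relIndex_eq_zero_of_le_right hL) hindex

theorem finrank_inf_eq_finrank {V : Type*} [NormedAddCommGroup V] [NormedSpace ℝ V]
    [FiniteDimensional ℝ V] {Λ Λ' L : Submodule ℤ V} [DiscreteTopology L]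
    (hindex : Λ'.toAddSubgroup.relIndex Λ.toAddSubgroup ≠ 0) (hL : L ≤ Λ) :
    Module.finrank ℤ (Λ' ⊓ L : Submodule ℤ V) = Module.finrank ℤ L := by
  have : DiscreteTopology (Λ' ⊓ L : Submodule ℤ V) := .of_subset ‹_› inf_le_right
  rw [finrank_int_eq_finrank_span, finrank_int_eq_finrank_span, span_inf_eq_span hindex hL]

variable {d : ℕ} {Λ Λ' L L' : Submodule ℤ (E d)}

theorem latticeVolume_eq_covolume_comap {W : Submodule ℝ (E d)}
    (hW : span ℝ (L : Set (E d)) = W) :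
    latticeVolume L = ZLattice.covolume (ZLattice.comap ℝ L W.subtype) volume := by
  subst hW
  rfl

theorem latticeVolume_pos (L : Submodule ℤ (E d)) [DiscreteTopology L] : 0 < latticeVolume L :=
  have := discreteTopology_comap_subtype L (span ℝ (L : Set (E d)))
  have : IsZLattice ℝ (ZLattice.comap ℝ L (span ℝ (L : Set (E d))).subtype) :=
    ⟨span_comap_subtype rfl⟩
  ZLattice.covolume_pos _ volume

theorem latticeVolume_eq_relIndex_mul [DiscreteTopology L] (h : L' ≤ L)
    (hspan : span ℝ (L' : Set (E d)) = span ℝ (L : Set (E d))) :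
    latticeVolume L' = L'.toAddSubgroup.relIndex L.toAddSubgroup * latticeVolume L := by
  have : DiscreteTopology L' := .of_subset ‹_› h
  set W := span ℝ (L : Set (E d)) with hW
  have := discreteTopology_comap_subtype L W
  have := discreteTopology_comap_subtype L' W
  have : IsZLattice ℝ (ZLattice.comap ℝ L W.subtype) := ⟨span_comap_subtype rfl⟩
  have : IsZLattice ℝ (ZLattice.comap ℝ L' W.subtype) := ⟨span_comap_subtype hspan⟩
  have hindex := ZLattice.covolume_div_covolume_eq_relIndex' (ZLattice.comap ℝ L' W.subtype)
    (ZLattice.comap ℝ L W.subtype) (fun _ hx => h hx)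
  rw [← latticeVolume_eq_covolume_comap rfl, ← latticeVolume_eq_covolume_comap hspan,
    relIndex_comap_subtype hW.ge] at hindex
  rw [← hindex, div_mul_cancel₀ _ (latticeVolume_pos L).ne']

theorem latticeVolume_inf_div_latticeVolume [DiscreteTopology Λ] (h : Λ' ≤ Λ)
    (hindex : Λ'.toAddSubgroup.relIndex Λ.toAddSubgroup ≠ 0) (hL : L ≤ Λ) :
    latticeVolume (Λ' ⊓ L) / latticeVolume Λ' =
      latticeVolume L / latticeVolume Λ / (Λ' ⊔ L).toAddSubgroup.relIndex Λ.toAddSubgroup := by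
  have : DiscreteTopology L := .of_subset ‹_› hL
  have hvol : latticeVolume (Λ' ⊓ L) =
      Λ'.toAddSubgroup.relIndex L.toAddSubgroup * latticeVolume L := by
    rw [latticeVolume_eq_relIndex_mul inf_le_right (span_inf_eq_span hindex hL),
      ← AddSubgroup.inf_relIndex_right Λ'.toAddSubgroup L.toAddSubgroup]
    rfl
  have hvol' : latticeVolume Λ' =
      Λ'.toAddSubgroup.relIndex Λ.toAddSubgroup * latticeVolume Λ :=
    latticeVolume_eq_relIndex_mul h (span_eq_span_of_relIndex_ne_zero
      (A := Λ'.toAddSubgroup) (B := Λ.toAddSubgroup) h hindex)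
  have hfactor : Λ'.toAddSubgroup.relIndex L.toAddSubgroup *
      (Λ' ⊔ L).toAddSubgroup.relIndex Λ.toAddSubgroup =
        Λ'.toAddSubgroup.relIndex Λ.toAddSubgroup := by
    rw [sup_toAddSubgroup, ← AddSubgroup.relIndex_sup_left, AddSubgroup.relIndex_mul_relIndex]
    exacts [le_sup_left, sup_le h hL]
  have hpos : (Λ'.toAddSubgroup.relIndex L.toAddSubgroup : ℝ) ≠ 0 :=
    Nat.cast_ne_zero.2 (mt (AddSubgroup.relIndex_eq_zero_of_le_right hL) hindex)
  rw [hvol, hvol', ← hfactor, Nat.cast_mul, mul_assoc, mul_div_mul_left _ _ hpos,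
    div_div, mul_comm (latticeVolume Λ)]

end LatticeVolume

section Components

open Topology

variable {X Y : Type*} [TopologicalSpace X] [TopologicalSpace Y]

theorem discreteTopology_connectedComponents_of_locallyFinite {ι : Type*} {C : ι → Set X}
    (hfinite : LocallyFinite C) (hclosed : ∀ i, IsClosed (C i))
    (hconn : ∀ i, IsPreconnected (C i)) (hcover : ⋃ i, C i = Set.univ) :
    DiscreteTopology (ConnectedComponents X) := by
  refine ConnectedComponents.discreteTopology_iff.2 fun x => ?_
  have hcompl : (connectedComponent x)ᶜ =
      ⋃ i : {i // Disjoint (C i) (connectedComponent x)}, C i := by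
    refine Set.Subset.antisymm (fun y hy => ?_)
      (Set.iUnion_subset fun i => i.2.subset_compl_right)
    obtain ⟨i, hi⟩ := Set.mem_iUnion.1 (hcover.ge (Set.mem_univ y))
    refine Set.mem_iUnion.2 ⟨⟨i, Set.disjoint_left.2 fun z hzi hzx => hy ?_⟩, hi⟩
    exact connectedComponent_eq hzx ▸ (hconn i).subset_connectedComponent hzi hi
  rw [← isClosed_compl_iff, hcompl]
  exact (hfinite.comp_injective Subtype.val_injective).isClosed_iUnion fun i => hclosed i

theorem mapsTo_connectedComponentIn {g : X → Y} (hg : Continuous g) {A : Set X} {B : Set Y}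
    (hmaps : Set.MapsTo g A B) {x : X} (hx : x ∈ A) :
    Set.MapsTo g (connectedComponentIn A x) (connectedComponentIn B (g x)) :=
  (hg.continuousOn.mapsTo_connectedComponentIn hx).mono_right
    (connectedComponentIn_mono _ hmaps.image_subset)

theorem isClopen_biUnion_connectedComponent [DiscreteTopology (ConnectedComponents X)]
    (U : Set X) : IsClopen (⋃ x ∈ U, connectedComponent x) := by
  rw [← connectedComponents_preimage_image]
  exact (isClopen_discrete _).preimage ConnectedComponents.continuous_coe

theorem image_connectedComponent_of_isQuotientMap [DiscreteTopology (ConnectedComponents X)]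
    {q : X → Y} (hq : IsQuotientMap q)
    (hfiber : ∀ x y, q x = q y → q '' connectedComponent x = q '' connectedComponent y) (x : X) :
    q '' connectedComponent x = connectedComponent (q x) := by
  refine (hq.continuous.image_connectedComponent_subset x).antisymm ?_
  suffices hclopen : IsClopen (q '' connectedComponent x) from
    hclopen.connectedComponent_subset ⟨x, mem_connectedComponent, rfl⟩
  have hsaturated : q ⁻¹' (q '' connectedComponent x) =
      ⋃ y ∈ q ⁻¹' (q '' connectedComponent x), connectedComponent y := by
    refine Set.Subset.antisymm
      (fun y hy => Set.mem_biUnion hy mem_connectedComponent) (Set.iUnion₂_subset ?_)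
    rintro y ⟨z, hz, hzy⟩
    rw [← Set.image_subset_iff, ← hfiber z y hzy, connectedComponent_eq hz]
  rw [← hq.isClopen_preimage, hsaturated]
  exact isClopen_biUnion_connectedComponent _

omit [TopologicalSpace Y] in
theorem deckTransformation_image_connectedComponentIn {π : X → Y} {e : X ≃ₜ X} (he : π ∘ e = π)
    {T : Set Y} {x : X} (hx : x ∈ π ⁻¹' T) :
    e '' connectedComponentIn (π ⁻¹' T) x = connectedComponentIn (π ⁻¹' T) (e x) := by
  have hinvariant : e '' (π ⁻¹' T) = π ⁻¹' T := by
    conv_lhs => rw [← he, Set.preimage_comp, e.image_preimage]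
  rw [e.image_connectedComponentIn hx, hinvariant]

theorem image_connectedComponentIn_of_deckTransformation {π : X → Y} (hπ : IsOpenQuotientMap π)
    (hdeck : ∀ x y, π x = π y → ∃ e : X ≃ₜ X, π ∘ e = π ∧ e x = y) {T : Set Y}
    [DiscreteTopology (ConnectedComponents (π ⁻¹' T))] {x : X} (hx : π x ∈ T) :
    π '' connectedComponentIn (π ⁻¹' T) x = connectedComponentIn T (π x) := by
  have himage : ∀ z : π ⁻¹' T, Subtype.val '' (T.restrictPreimage π '' connectedComponent z) =
      π '' connectedComponentIn (π ⁻¹' T) z := fun z => by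
    rw [connectedComponentIn_eq_image z.2, Set.image_image, Set.image_image]
    rfl
  have hfiber : ∀ y z : π ⁻¹' T, T.restrictPreimage π y = T.restrictPreimage π z →
      T.restrictPreimage π '' connectedComponent y =
        T.restrictPreimage π '' connectedComponent z := by
    intro y z hyz
    obtain ⟨e, he, hey⟩ := hdeck y z (congrArg Subtype.val hyz)
    rw [← Subtype.val_injective.image_injective.eq_iff, himage, himage, ← hey,
      ← deckTransformation_image_connectedComponentIn he y.2, ← Set.image_comp, he]
  rw [← himage ⟨x, hx⟩, connectedComponentIn_eq_image hx, image_connectedComponent_of_isQuotientMap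
    (hπ.restrictPreimage T).isQuotientMap hfiber]
  rfl

end Components

section Torus

variable {d : ℕ} {Λ : Submodule ℤ (E d)} {T : Set (Torus Λ)} {u x y : E d}

theorem mem_translate_iff {A : Set (E d)} : x ∈ translate u A ↔ x - u ∈ A :=
  ⟨fun ⟨_, hz, hzx⟩ => eq_sub_of_add_eq hzx ▸ hz, fun hx => ⟨x - u, hx, sub_add_cancel x u⟩⟩

theorem mkQ_comp_addRight (hu : u ∈ Λ) : Λ.mkQ ∘ Homeomorph.addRight u = Λ.mkQ := by
  ext x
  exact (Submodule.Quotient.eq Λ).2 (by simpa using hu)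

theorem add_mem_lift_iff (hu : u ∈ Λ) : x + u ∈ lift T ↔ x ∈ lift T :=
  (congrArg (· ∈ T) (congrFun (mkQ_comp_addRight hu) x)).to_iff

theorem translate_connectedComponentIn_lift (hu : u ∈ Λ) (hx : x ∈ lift T) :
    translate u (connectedComponentIn (lift T) x) = connectedComponentIn (lift T) (x + u) :=
  deckTransformation_image_connectedComponentIn (mkQ_comp_addRight hu) hx

theorem connectedComponentIn_lift_connectedComponentIn {p : Torus Λ}
    (hx : x ∈ lift (connectedComponentIn T p)) :
    connectedComponentIn (lift (connectedComponentIn T p)) x = connectedComponentIn (lift T) x := by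
  have hxT : x ∈ lift T := connectedComponentIn_subset T p hx
  refine Set.Subset.antisymm
    (connectedComponentIn_mono x (Set.preimage_mono (connectedComponentIn_subset T p)))
    (isPreconnected_connectedComponentIn.subset_connectedComponentIn
      (mem_connectedComponentIn hxT) fun y hy => ?_)
  have hyx := mapsTo_connectedComponentIn Λ.isOpenQuotientMap_mkQ.continuous
    (Set.mapsTo_preimage Λ.mkQ T) hxT hy
  exact connectedComponentIn_eq hx ▸ hyx

variable [DiscreteTopology (ConnectedComponents (lift T))]

theorem image_mkQ_connectedComponentIn_lift (hx : x ∈ lift T) :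
    Λ.mkQ '' connectedComponentIn (lift T) x = connectedComponentIn T (Λ.mkQ x) := by
  have : DiscreteTopology (ConnectedComponents (Λ.mkQ ⁻¹' T)) := ‹_›
  refine image_connectedComponentIn_of_deckTransformation Λ.isOpenQuotientMap_mkQ ?_ hx
  intro y z hyz
  exact ⟨Homeomorph.addRight (z - y),
    mkQ_comp_addRight ((Submodule.Quotient.eq Λ).1 hyz.symm), add_sub_cancel y z⟩

theorem mkQ_mem_connectedComponentIn_iff (hx : x ∈ lift T) :
    Λ.mkQ y ∈ connectedComponentIn T (Λ.mkQ x) ↔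
      ∃ u ∈ Λ, y ∈ connectedComponentIn (lift T) (x + u) := by
  rw [← image_mkQ_connectedComponentIn_lift hx]
  constructor
  · rintro ⟨z, hz, hzy⟩
    have hu : y - z ∈ Λ := (Submodule.Quotient.eq Λ).1 hzy.symm
    refine ⟨y - z, hu, ?_⟩
    rwa [← translate_connectedComponentIn_lift hu hx, mem_translate_iff, sub_sub_cancel]
  · rintro ⟨u, hu, hy⟩
    rw [← translate_connectedComponentIn_lift hu hx, mem_translate_iff] at hy
    exact ⟨y - u, hy, (Submodule.Quotient.eq Λ).2 (by simpa using hu)⟩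

theorem mem_periodicityLattice_connectedComponentIn_iff (hx : x ∈ lift T) :
    u ∈ periodicityLattice (connectedComponentIn T (Λ.mkQ x)) ↔
      u ∈ Λ ∧ x + u ∈ connectedComponentIn (lift T) x := by
  refine and_congr_right fun hu => ⟨fun hinvariant => ?_, ?_⟩
  · have hxC : x ∈ lift (connectedComponentIn T (Λ.mkQ x)) := mem_connectedComponentIn hx
    rw [← connectedComponentIn_lift_connectedComponentIn hxC]
    exact (hinvariant _ ⟨x, hxC, rfl⟩).subset ⟨x, mem_connectedComponentIn hxC, rfl⟩
  · rintro hxu _ ⟨y, hy, rfl⟩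
    obtain ⟨v, hv, hyv⟩ := (mkQ_mem_connectedComponentIn_iff hx).1 hy
    have hfixed : translate u (connectedComponentIn (lift T) x) = connectedComponentIn (lift T) x :=
      (translate_connectedComponentIn_lift hu hx).trans (connectedComponentIn_eq hxu).symm
    dsimp only
    rw [connectedComponentIn_lift_connectedComponentIn hy, ← connectedComponentIn_eq hyv,
      ← translate_connectedComponentIn_lift hv hx, translate_translate, add_comm,
      ← translate_translate, hfixed]

end Torus

section MergeTree

variable {X Y : Type} [TopologicalSpace X] [TopologicalSpace Y] {S : ℝ → Set X} {T : ℝ → Set Y}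

/-- The point of the merge tree of `S` that represents the component of `x` in `S t`. -/
def MergeTree.mk {t : ℝ} {x : X} (hx : x ∈ S t) : MergeTree S :=
  Quotient.mk (mergeSetoid S) ⟨(x, t), hx⟩

theorem MergeTree.exists_eq_mk (a : MergeTree S) : ∃ t x, ∃ hx : x ∈ S t, a = .mk hx := by
  obtain ⟨⟨⟨x, t⟩, hx⟩, rfl⟩ := Quotient.exists_rep a
  exact ⟨t, x, hx, rfl⟩

theorem MergeTree.mk_eq_mk_iff {s t : ℝ} {x y : X} (hx : x ∈ S s) (hy : y ∈ S t) :
    MergeTree.mk hx = MergeTree.mk hy ↔ s = t ∧ y ∈ connectedComponentIn (S s) x := by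
  refine Quotient.eq.trans (and_congr_right ?_)
  rintro rfl
  exact ⟨fun heq => heq ▸ mem_connectedComponentIn hy, connectedComponentIn_eq⟩

/-- The map of merge trees induced by a continuous map that preserves sublevel sets. -/
def MergeTree.map (g : X → Y) (hg : Continuous g) (hmaps : ∀ t, Set.MapsTo g (S t) (T t)) :
    MergeTree S → MergeTree T :=
  Quotient.map' (fun p => ⟨(g p.1.1, p.1.2), hmaps _ p.2⟩) (by
    rintro ⟨⟨x, s⟩, hx⟩ ⟨⟨y, t⟩, hy⟩ ⟨hst, hxy⟩
    dsimp only at hst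
    subst hst
    exact ⟨rfl, connectedComponentIn_eq (mapsTo_connectedComponentIn hg (hmaps s) hx
      (hxy ▸ mem_connectedComponentIn hy))⟩)

variable {g : X → Y} (hg : Continuous g) (hmaps : ∀ t, Set.MapsTo g (S t) (T t))

theorem MergeTree.continuous_map : Continuous (map g hg hmaps) :=
  Continuous.quotient_map' (Continuous.subtype_mk (by fun_prop) _) _

theorem MergeTree.height_map (a : MergeTree S) : (map g hg hmaps a).height = a.height := by
  obtain ⟨t, x, hx, rfl⟩ := a.exists_eq_mk
  rfl

/-- The merge tree of `S`, in which the frequency of a point is the value of `F` at the component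
that it represents. -/
def decoratedMergeTree (S : ℝ → Set X) (F : Set X → RMonomial) : DecoratedTree X where
  Point := MergeTree S
  top := inferInstance
  component := MergeTree.component
  height := MergeTree.height
  frequency a := F a.component

variable {F : Set X → RMonomial} {G : Set Y → RMonomial}

theorem covers_mk_mk_iff (hS : Monotone S) {s t : ℝ} {x y : X} (hx : x ∈ S t) (hy : y ∈ S s) :
    (decoratedMergeTree S F).Covers (MergeTree.mk hx) (MergeTree.mk hy) ↔
      s ≤ t ∧ y ∈ connectedComponentIn (S t) x :=
  and_congr_right fun hst => ⟨fun hsub => hsub (mem_connectedComponentIn hy),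
    fun hyx => (connectedComponentIn_mono y (hS hst)).trans (connectedComponentIn_eq hyx).ge⟩

theorem covers_map_map (hT : Monotone T) {a b : MergeTree S}
    (hcovers : (decoratedMergeTree S F).Covers b a) :
    (decoratedMergeTree T G).Covers (MergeTree.map g hg hmaps b) (MergeTree.map g hg hmaps a) := by
  obtain ⟨s, x, hx, rfl⟩ := a.exists_eq_mk
  obtain ⟨t, y, hy, rfl⟩ := b.exists_eq_mk
  exact (covers_mk_mk_iff hT _ _).2 ⟨hcovers.1, mapsTo_connectedComponentIn hg (hmaps t) hy
    (hcovers.2 (mem_connectedComponentIn hx))⟩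

end MergeTree

section TorusMergeTree

variable {d : ℕ} {Λ : Submodule ℤ (E d)} {S : ℝ → Set (Torus Λ)} {s t : ℝ} {x y : E d}

/-- The point of a merge tree on the torus that represents the component of `S t` into which the
point `x` of `ℝ^d` projects. -/
def MergeTree.mkLift (hx : x ∈ lift (S t)) : MergeTree S :=
  MergeTree.mk (x := Λ.mkQ x) hx

theorem MergeTree.exists_eq_mkLift (a : MergeTree S) :
    ∃ t x, ∃ hx : x ∈ lift (S t), a = .mkLift hx := by
  obtain ⟨t, p, hp, rfl⟩ := a.exists_eq_mk
  obtain ⟨x, rfl⟩ := Λ.mkQ_surjective p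
  exact ⟨t, x, hp, rfl⟩

variable [∀ t, DiscreteTopology (ConnectedComponents (lift (S t)))]

theorem MergeTree.mkLift_eq_mkLift_iff (hx : x ∈ lift (S s)) (hy : y ∈ lift (S t)) :
    MergeTree.mkLift hx = MergeTree.mkLift hy ↔
      s = t ∧ ∃ u ∈ Λ, y ∈ connectedComponentIn (lift (S s)) (x + u) :=
  (MergeTree.mk_eq_mk_iff _ _).trans (and_congr_right fun _ => mkQ_mem_connectedComponentIn_iff hx)

theorem covers_mkLift_mkLift_iff (hS : Monotone S) {F : Set (Torus Λ) → RMonomial}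
    (hx : x ∈ lift (S t)) (hy : y ∈ lift (S s)) :
    (decoratedMergeTree S F).Covers (MergeTree.mkLift hx) (MergeTree.mkLift hy) ↔
      s ≤ t ∧ ∃ u ∈ Λ, y ∈ connectedComponentIn (lift (S t)) (x + u) :=
  (covers_mk_mk_iff hS _ _).trans (and_congr_right fun _ => mkQ_mem_connectedComponentIn_iff hx)

theorem mem_periodicityLattice_mkLift_iff {u : E d} (hx : x ∈ lift (S t)) :
    u ∈ periodicityLattice (MergeTree.mkLift hx).component ↔
      u ∈ Λ ∧ x + u ∈ connectedComponentIn (lift (S t)) x :=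
  mem_periodicityLattice_connectedComponentIn_iff hx

end TorusMergeTree

section Interleaving

variable {X Y : Type} {M : DecoratedTree X} {N : DecoratedTree Y}

theorem RMonomial.le_of_eq {m n : RMonomial} (hmn : m = n) : m ≤ n :=
  Or.inr ⟨congrArg _ hmn, (congrArg _ hmn).le⟩

theorem interleavingDist_eq_zero_of_homeomorph (e : M.Point ≃ₜ N.Point)
    (hheight : ∀ a, N.height (e a) = M.height a)
    (hfrequency : ∀ a, N.frequency (e a) = M.frequency a) : interleavingDist M N = 0 := by
  have hheight' (b) : M.height (e.symm b) = N.height b := by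
    rw [← hheight, e.apply_symm_apply]
  have hfrequency' (b) : M.frequency (e.symm b) = N.frequency b := by
    rw [← hfrequency, e.apply_symm_apply]
  have hcompatible : Compatible M N 0 e e.symm :=
    { continuous_left := e.continuous
      continuous_right := e.symm.continuous
      height_left := fun a => by simpa using hheight a
      height_right := fun b => by simpa using hheight' b
      covers_left := fun a => by
        rw [e.symm_apply_apply]
        exact ⟨le_rfl, subset_rfl⟩
      covers_right := fun b => by
        rw [e.apply_symm_apply]
        exact ⟨le_rfl, subset_rfl⟩
      frequency_left := fun a => RMonomial.le_of_eq (hfrequency a)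
      frequency_right := fun b => RMonomial.le_of_eq (hfrequency' b) }
  exact le_antisymm (iInf₂_le 0 ⟨e, e.symm, hcompatible⟩) zero_le

theorem interleavingDist_subtree_eq_zero_of_homeomorph (e : M.Point ≃ₜ N.Point)
    (hheight : ∀ a, N.height (e a) = M.height a)
    (hfrequency : ∀ a, N.frequency (e a) = M.frequency a)
    (hcovers : ∀ a b, M.Covers b a ↔ N.Covers (e b) (e a)) (b : M.Point) :
    interleavingDist (M.subtree b) (N.subtree (e b)) = 0 :=
  interleavingDist_eq_zero_of_homeomorph (M := M.subtree b) (N := N.subtree (e b))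
    (e.subtype fun a => hcovers a b) (fun a => hheight a.1) fun a => hfrequency a.1

end Interleaving

section Splintering

variable {d : ℕ} {Λ Λ' : Submodule ℤ (E d)} (h : Λ' ≤ Λ) (T : ℝ → Set (Torus Λ))

/-- The family of sublevel sets on the covering torus `ℝ^d / Λ'` that lie over those of `T`. -/
def pullback (t : ℝ) : Set (Torus Λ') := factor h ⁻¹' T t

theorem continuous_factor : Continuous (factor h) :=
  Λ'.isOpenQuotientMap_mkQ.isQuotientMap.continuous_iff.2 Λ.isOpenQuotientMap_mkQ.continuous

theorem lift_pullback (t : ℝ) : lift (pullback h T t) = lift (T t) := rfl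

theorem monotone_pullback {T : ℝ → Set (Torus Λ)} (hT : Monotone T) : Monotone (pullback h T) :=
  fun _ _ hst => Set.preimage_mono (hT hst)

instance [∀ t, DiscreteTopology (ConnectedComponents (lift (T t)))] (t : ℝ) :
    DiscreteTopology (ConnectedComponents (lift (pullback h T t))) :=
  inferInstanceAs (DiscreteTopology (ConnectedComponents (lift (T t))))

/-- The map of merge trees induced by the covering of tori `ℝ^d / Λ' → ℝ^d / Λ`. -/
def splinterMap : MergeTree (pullback h T) → MergeTree T :=
  MergeTree.map (factor h) (continuous_factor h) fun _ => Set.mapsTo_preimage _ _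

variable {T}

theorem add_mkQ_mem_pullback (u : Λ) (t : ℝ) :
    Set.MapsTo (· + Λ'.mkQ u) (pullback h T t) (pullback h T t) := by
  intro p hp
  have hu : factor h (Λ'.mkQ u) = 0 := (Submodule.Quotient.mk_eq_zero Λ).2 u.2
  simpa only [pullback, Set.mem_preimage, map_add, hu, add_zero] using hp

/-- The action of `Λ` on the merge tree over `ℝ^d / Λ'` by deck transformations of the covering
torus: `u` sends the component of a point `p` to the component of `p + u`. -/
instance : AddAction Λ (MergeTree (pullback h T)) where
  vadd u := MergeTree.map (· + Λ'.mkQ u) (continuous_add_const _) (add_mkQ_mem_pullback h u)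
  zero_vadd a := by
    obtain ⟨t, p, hp, rfl⟩ := a.exists_eq_mk
    refine congrArg (Quotient.mk _) (Subtype.ext (Prod.ext ?_ rfl))
    simp
  add_vadd u v a := by
    obtain ⟨t, p, hp, rfl⟩ := a.exists_eq_mk
    refine congrArg (Quotient.mk _) (Subtype.ext (Prod.ext ?_ rfl))
    change p + Λ'.mkQ (u + v) = p + Λ'.mkQ v + Λ'.mkQ u
    rw [map_add, add_assoc, add_comm (Λ'.mkQ u)]

instance : ContinuousConstVAdd Λ (MergeTree (pullback h T)) where
  continuous_const_vadd _ := MergeTree.continuous_map _ _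

theorem vadd_mkLift (u : Λ) {t : ℝ} {x : E d} (hx : x ∈ lift (pullback h T t))
    (hxu : x + u ∈ lift (pullback h T t)) : u +ᵥ MergeTree.mkLift hx = MergeTree.mkLift hxu :=
  rfl

theorem splinterMap_mkLift {t : ℝ} {x : E d} (hx : x ∈ lift (pullback h T t))
    (hx' : x ∈ lift (T t)) : splinterMap h T (MergeTree.mkLift hx) = MergeTree.mkLift hx' :=
  rfl

theorem height_vadd (u : Λ) (a : MergeTree (pullback h T)) : (u +ᵥ a).height = a.height :=
  MergeTree.height_map _ _ a

theorem covers_vadd_vadd_iff (hT : Monotone T) {F : Set (Torus Λ') → RMonomial} (u : Λ)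
    (a b : MergeTree (pullback h T)) :
    (decoratedMergeTree (pullback h T) F).Covers b a ↔
      (decoratedMergeTree (pullback h T) F).Covers (u +ᵥ b) (u +ᵥ a) := by
  refine ⟨covers_map_map _ _ (monotone_pullback h hT), fun hcovers => ?_⟩
  have hneg : (decoratedMergeTree (pullback h T) F).Covers (-u +ᵥ (u +ᵥ b)) (-u +ᵥ (u +ᵥ a)) :=
    covers_map_map _ _ (monotone_pullback h hT) hcovers
  rwa [neg_vadd_vadd, neg_vadd_vadd] at hneg

theorem splinterMap_surjective : Function.Surjective (splinterMap h T) := by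
  intro c
  obtain ⟨t, x, hx, rfl⟩ := c.exists_eq_mkLift
  exact ⟨MergeTree.mkLift (S := pullback h T) hx, rfl⟩

section Fiber

variable [∀ t, DiscreteTopology (ConnectedComponents (lift (T t)))]

theorem splinterMap_vadd (u : Λ) (a : MergeTree (pullback h T)) :
    splinterMap h T (u +ᵥ a) = splinterMap h T a := by
  obtain ⟨t, x, hx, rfl⟩ := a.exists_eq_mkLift
  have hxT : x ∈ lift (T t) := hx
  have hxuT : x + u ∈ lift (T t) := (add_mem_lift_iff u.2).2 hxT
  have hxu : x + u ∈ lift (pullback h T t) := hxuT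
  rw [vadd_mkLift h u hx hxu, splinterMap_mkLift h hxu hxuT, splinterMap_mkLift h hx hxT, eq_comm,
    MergeTree.mkLift_eq_mkLift_iff]
  exact ⟨rfl, u, u.2, mem_connectedComponentIn hxuT⟩

theorem splinterMap_fiber_eq_orbit (a : MergeTree (pullback h T)) :
    splinterMap h T ⁻¹' {splinterMap h T a} = AddAction.orbit Λ a := by
  refine Set.Subset.antisymm (fun b hb => ?_) ?_
  · obtain ⟨s, x, hx, rfl⟩ := a.exists_eq_mkLift
    obtain ⟨t, y, hy, rfl⟩ := b.exists_eq_mkLift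
    obtain ⟨rfl, u, hu, hyu⟩ := (MergeTree.mkLift_eq_mkLift_iff (S := T) hx hy).1 hb.symm
    refine ⟨⟨u, hu⟩, (MergeTree.mkLift_eq_mkLift_iff (S := pullback h T) _ hy).2
      ⟨rfl, 0, Λ'.zero_mem, ?_⟩⟩
    rwa [add_zero]
  · rintro _ ⟨u, rfl⟩
    exact splinterMap_vadd h u a

theorem periodicityLattice_component_eq_inf (a : MergeTree (pullback h T)) :
    periodicityLattice a.component = Λ' ⊓ periodicityLattice (splinterMap h T a).component := by
  obtain ⟨t, x, hx, rfl⟩ := a.exists_eq_mkLift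
  have hxT : x ∈ lift (T t) := hx
  ext u
  rw [splinterMap_mkLift h hx hxT, mem_inf, mem_periodicityLattice_mkLift_iff,
    mem_periodicityLattice_mkLift_iff, lift_pullback]
  exact and_congr_right fun hu => (and_iff_right (h hu)).symm

theorem vadd_eq_self_iff (u : Λ) (a : MergeTree (pullback h T)) :
    u +ᵥ a = a ↔ (u : E d) ∈ Λ' ⊔ periodicityLattice (splinterMap h T a).component := by
  obtain ⟨t, x, hx, rfl⟩ := a.exists_eq_mkLift
  have hxT : x ∈ lift (T t) := hx
  have hxu : x + u ∈ lift (pullback h T t) := (add_mem_lift_iff (T := T t) u.2).2 hxT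
  have hfixed : u +ᵥ MergeTree.mkLift hx = MergeTree.mkLift hx ↔
      ∃ v ∈ Λ', x + (u - v) ∈ connectedComponentIn (lift (T t)) x := by
    rw [vadd_mkLift h u hx hxu, eq_comm, MergeTree.mkLift_eq_mkLift_iff, and_iff_right rfl]
    refine exists_congr fun v => and_congr_right fun hv => ?_
    rw [← translate_connectedComponentIn_lift hv hx, mem_translate_iff, add_sub_assoc,
      lift_pullback]
  rw [splinterMap_mkLift h hx hxT, hfixed]
  simp only [mem_sup, mem_periodicityLattice_mkLift_iff]
  constructor
  · rintro ⟨v, hv, hxuv⟩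
    exact ⟨v, hv, u - v, ⟨Λ.sub_mem u.2 (h hv), hxuv⟩, add_sub_cancel v _⟩
  · rintro ⟨v, hv, w, ⟨-, hxw⟩, hvw⟩
    exact ⟨v, hv, by rwa [← hvw, add_sub_cancel_left]⟩

theorem ncard_splinterMap_fiber (a : MergeTree (pullback h T)) :
    (splinterMap h T ⁻¹' {splinterMap h T a}).ncard =
      (Λ' ⊔ periodicityLattice (splinterMap h T a).component).toAddSubgroup.relIndex
        Λ.toAddSubgroup := by
  have hstabilizer : AddAction.stabilizer Λ a = AddSubgroup.comap Λ.subtype.toAddMonoidHom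
      (Λ' ⊔ periodicityLattice (splinterMap h T a).component).toAddSubgroup :=
    AddSubgroup.ext fun u => vadd_eq_self_iff h u a
  have hrange : Λ.subtype.toAddMonoidHom.range = Λ.toAddSubgroup :=
    SetLike.coe_injective Subtype.range_coe
  rw [splinterMap_fiber_eq_orbit, ← AddAction.index_stabilizer, hstabilizer,
    AddSubgroup.index_comap, hrange]

theorem finite_splinterMap_fiber (hindex : Λ'.toAddSubgroup.relIndex Λ.toAddSubgroup ≠ 0)
    (c : MergeTree T) : (splinterMap h T ⁻¹' {c}).Finite := by
  obtain ⟨a, rfl⟩ := splinterMap_surjective h c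
  refine Set.finite_of_ncard_ne_zero fun hzero => hindex ?_
  rw [ncard_splinterMap_fiber] at hzero
  exact AddSubgroup.relIndex_eq_zero_of_le_left (fun _ hu => mem_sup_left hu) hzero

theorem image_splinterMap_covers (hT : Monotone T) {F : Set (Torus Λ') → RMonomial}
    {G : Set (Torus Λ) → RMonomial} (a : MergeTree (pullback h T)) :
    splinterMap h T '' {b | (decoratedMergeTree (pullback h T) F).Covers a b} =
      {c | (decoratedMergeTree T G).Covers (splinterMap h T a) c} := by
  refine Set.Subset.antisymm
    (Set.image_subset_iff.2 fun b hb => covers_map_map _ _ hT hb) fun c hc => ?_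
  obtain ⟨t, x, hx, rfl⟩ := a.exists_eq_mkLift
  obtain ⟨s, y, hy, rfl⟩ := MergeTree.exists_eq_mkLift c
  obtain ⟨hst, u, hu, hyu⟩ := (covers_mkLift_mkLift_iff hT (x := x) hx hy).1 hc
  have hyux : y + -u ∈ connectedComponentIn (lift (pullback h T t)) (x + 0) := by
    rwa [← translate_connectedComponentIn_lift (T := T t) hu hx, mem_translate_iff,
      sub_eq_add_neg, ← add_zero x] at hyu
  exact ⟨-(⟨u, hu⟩ : Λ) +ᵥ MergeTree.mkLift (S := pullback h T) hy,
    (covers_mkLift_mkLift_iff (monotone_pullback h hT) hx _).2 ⟨hst, 0, Λ'.zero_mem, hyux⟩,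
    splinterMap_vadd h _ _⟩

end Fiber

section Frequency

variable [DiscreteTopology Λ] (hindex : Λ'.toAddSubgroup.relIndex Λ.toAddSubgroup ≠ 0)
include h hindex

theorem shadowMonomial_eq_divNat {C : Set (Torus Λ)} {C' : Set (Torus Λ')}
    (hC : periodicityLattice C' = Λ' ⊓ periodicityLattice C) :
    shadowMonomial C' = (shadowMonomial C).divNat
      ((Λ' ⊔ periodicityLattice C).toAddSubgroup.relIndex Λ.toAddSubgroup) := by
  have hL : periodicityLattice C ≤ Λ := fun _ hu => hu.1
  have : DiscreteTopology (periodicityLattice C) := .of_subset ‹_› hL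
  rw [shadowMonomial, shadowMonomial, hC, finrank_inf_eq_finrank hindex hL,
    latticeVolume_inf_div_latticeVolume h hindex hL, RMonomial.divNat, div_mul_eq_mul_div]

variable [∀ t, DiscreteTopology (ConnectedComponents (lift (T t)))]

theorem shadowMonomial_component_eq_divNat (a : MergeTree (pullback h T)) :
    shadowMonomial a.component = (shadowMonomial (splinterMap h T a).component).divNat
      (splinterMap h T ⁻¹' {splinterMap h T a}).ncard := by
  rw [ncard_splinterMap_fiber]
  exact shadowMonomial_eq_divNat h hindex (periodicityLattice_component_eq_inf h a)

theorem interleavingDist_subtree_vadd_eq_zero (hT : Monotone T) (u : Λ)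
    (a : MergeTree (pullback h T)) :
    interleavingDist ((decoratedMergeTree (pullback h T) shadowMonomial).subtree a)
      ((decoratedMergeTree (pullback h T) shadowMonomial).subtree (u +ᵥ a)) = 0 := by
  let e : MergeTree (pullback h T) ≃ₜ MergeTree (pullback h T) := Homeomorph.vadd u
  have hfrequency (b : MergeTree (pullback h T)) :
      shadowMonomial (u +ᵥ b).component = shadowMonomial b.component := by
    rw [shadowMonomial_component_eq_divNat h hindex, shadowMonomial_component_eq_divNat h hindex,
      splinterMap_vadd]
  exact interleavingDist_subtree_eq_zero_of_homeomorph
    (M := decoratedMergeTree (pullback h T) shadowMonomial)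
    (N := decoratedMergeTree (pullback h T) shadowMonomial)
    e (height_vadd h u) hfrequency (covers_vadd_vadd_iff h hT u) a

end Frequency

end Splintering

section Cells

variable {d : ℕ} {K : CellComplex d}

theorem CellComplex.isClosed_cell (σ : K.cells) : IsClosed (σ : Set (E d)) := by
  have : CompactSpace (UnitBall (K.dim σ)) :=
    isCompact_iff_compactSpace.1 (isCompact_closedBall _ _)
  exact (isCompact_iff_compactSpace.2 (K.chart σ).compactSpace).isClosed

theorem CellComplex.isPreconnected_cell (σ : K.cells) : IsPreconnected (σ : Set (E d)) := by
  have : PreconnectedSpace (UnitBall (K.dim σ)) :=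
    isPreconnected_iff_preconnectedSpace.1 (convex_closedBall _ _).isPreconnected
  have hrange : Set.range (Subtype.val ∘ K.chart σ) = (σ : Set (E d)) := by
    rw [(K.chart σ).surjective.range_comp, Subtype.range_coe]
  exact hrange ▸ isPreconnected_range (continuous_subtype_val.comp (K.chart σ).continuous)

/-- The union of the cells of value at most `t`. -/
def CellFilter.sublevel (f : CellFilter K) (t : ℝ) : Set (E d) :=
  ⋃ σ : {σ : K.cells // f.val σ ≤ t}, (σ : Set (E d))

variable {f : CellFilter K}

instance (t : ℝ) : DiscreteTopology (ConnectedComponents (f.sublevel t)) := by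
  have hlocallyFinite := K.locallyFinite.comp_injective
    (Subtype.val_injective (p := fun σ => f.val σ ≤ t))
  refine discreteTopology_connectedComponents_of_locallyFinite
    (hlocallyFinite.preimage_continuous (g := ((↑) : f.sublevel t → E d)) continuous_subtype_val)
    (fun σ => (CellComplex.isClosed_cell σ.1).preimage continuous_subtype_val) (fun σ => ?_) ?_
  · refine Topology.IsInducing.subtypeVal.isPreconnected_image.1 ?_
    have hsubset : (σ : Set (E d)) ⊆ f.sublevel t :=
      Set.subset_iUnion (fun τ : {τ : K.cells // f.val τ ≤ t} => (τ : Set (E d))) σ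
    rw [Function.comp_apply, Subtype.image_preimage_coe, Set.inter_eq_right.2 hsubset]
    exact CellComplex.isPreconnected_cell σ.1
  · exact Set.preimage_iUnion.symm.trans (Subtype.coe_preimage_self (f.sublevel t))

variable {Λ Λ' : Submodule ℤ (E d)}

theorem lift_quotientSublevel (hK : K.IsPeriodic Λ) (hf : f.IsPeriodic Λ) (t : ℝ) :
    lift (f.quotientSublevel hf t) = f.sublevel t := by
  ext x
  simp only [lift, CellFilter.quotientSublevel, CellFilter.sublevel, Set.mem_preimage,
    Set.mem_iUnion, Set.mem_ofPred_eq]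
  constructor
  · rintro ⟨c, hc, hx⟩
    obtain ⟨σ, rfl⟩ := Quotient.exists_rep c
    obtain ⟨y, hy, hyx⟩ := hx
    have hu : x - y ∈ Λ := (Submodule.Quotient.eq Λ).1 hyx.symm
    exact ⟨⟨⟨translate (x - y) σ, hK σ σ.2 _ hu⟩, (hf σ _ _ hu rfl).ge.trans hc⟩,
      y, hy, add_sub_cancel y x⟩
  · rintro ⟨σ, hx⟩
    exact ⟨Quotient.mk _ σ.1, σ.2, x, hx, rfl⟩

theorem discreteTopology_connectedComponents_lift_quotientSublevel (hK : K.IsPeriodic Λ)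
    (hf : f.IsPeriodic Λ) (t : ℝ) :
    DiscreteTopology (ConnectedComponents (lift (f.quotientSublevel hf t))) := by
  rw [lift_quotientSublevel hK hf]
  infer_instance

theorem monotone_quotientSublevel (hf : f.IsPeriodic Λ) : Monotone (f.quotientSublevel hf) :=
  fun _ _ hst => Set.biUnion_subset_biUnion_left fun _ hc => le_trans hc hst

theorem quotientSublevel_mono_eq_pullback (hK : K.IsPeriodic Λ) (hf : f.IsPeriodic Λ)
    (h : Λ' ≤ Λ) :
    f.quotientSublevel (hf.mono h) = pullback h (f.quotientSublevel hf) := by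
  funext t
  refine Λ'.mkQ_surjective.preimage_injective ?_
  exact (lift_quotientSublevel (hK.mono h) (hf.mono h) t).trans (lift_quotientSublevel hK hf t).symm

theorem periodicMergeTree_mono_eq_decoratedMergeTree (hK : K.IsPeriodic Λ) (hf : f.IsPeriodic Λ)
    (h : Λ' ≤ Λ) : periodicMergeTree f Λ' (hf.mono h) =
      decoratedMergeTree (pullback h (f.quotientSublevel hf)) shadowMonomial :=
  congrArg (decoratedMergeTree · shadowMonomial) (quotientSublevel_mono_eq_pullback hK hf h)

end Cells

end PeriodicMerge

end

theorem mainTheorem2_general {d : ℕ} {Λ Λ' : Submodule ℤ (E d)} [DiscreteTopology Λ] (h : Λ' ≤ Λ)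
    (hindex : Λ'.toAddSubgroup.relIndex Λ.toAddSubgroup ≠ 0) {T : ℝ → Set (Torus Λ)}
    (hT : Monotone T) [∀ t, DiscreteTopology (ConnectedComponents (lift (T t)))] :
    Splinters (decoratedMergeTree (pullback h T) shadowMonomial)
      (decoratedMergeTree T shadowMonomial) :=
  ⟨splinterMap h T,
    { continuous := MergeTree.continuous_map _ _
      surjective := splinterMap_surjective h
      height_eq := MergeTree.height_map _ _
      finite_fiber := finite_splinterMap_fiber h hindex
      subtree_eq := by
        rintro _ a rfl b hb
        obtain ⟨u, rfl⟩ := (splinterMap_fiber_eq_orbit h a).subset hb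
        exact interleavingDist_subtree_vadd_eq_zero h hindex hT u a
      subtree_surj := by
        rintro _ a rfl
        exact image_splinterMap_covers h hT a
      frequency_eq := by
        rintro _ a rfl
        exact shadowMonomial_component_eq_divNat h hindex a }⟩

theorem mainTheorem2 (d : ℕ) (Λ Λ' : Submodule ℤ (E d))
    [DiscreteTopology Λ] [IsZLattice ℝ Λ] [DiscreteTopology Λ'] [IsZLattice ℝ Λ']
    (h : Λ' ≤ Λ) (K : CellComplex d) (hK : K.IsPeriodic Λ)
    (f : CellFilter K) (hf : f.IsPeriodic Λ) :
    Splinters (periodicMergeTree f Λ' (hf.mono h)) (periodicMergeTree f Λ hf) := by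
  have := discreteTopology_connectedComponents_lift_quotientSublevel hK hf
  exact periodicMergeTree_mono_eq_decoratedMergeTree hK hf h ▸ mainTheorem2_general h
    (relIndex_ne_zero_of_isZLattice h) (monotone_quotientSublevel hf)
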